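/- All vector spaces are over a field $\mathbb F$ of characteristic $0$. In expressions $(y\pm z)^n$, $n\in\mathbb Z$, and in $f(y+z)$ one expands in nonnegative powers of the second variable $z$; $\delta(x)=\sum_{n\in\mathbb Z}x^n$; $T(u\otimes v)=v\otimes u$. The graded dual of a graded space $W=\coprod_k W_{(k)}$ is $W'=\coprod_k \mathrm{Hom}(W_{(k)},\mathbb F)$, and tensor products carry the total grading. Let $(V,Y_V,c)$ be a graded vertex coalgebra. That is, $V=\coprod_{k\in\mathbb Z}V_{(k)}$ with $V_{(k)}=0$ for $k\ll 0$; $c:V\to\mathbb F$ and $Y_V(x):V\to (V\otimes V)[[x,x^{-1}]]$ are linear, $Y_V(x)v=\sum_{k\in\mathbb Z}\Delta_k(v)x^{-k-1}$ with $\Delta_k(v)\in (V\otimes V)_{(r+k+1)}$ for $v\in V_{(r)}$; and for all $v\in V$: $(c\otimes Id_V)Y_V(x)v=v$; $(Id_V\otimes c)Y_V(x)v\in V[[x]]$ with constant term $v$; $Y_V(x)v\in(V\otimes V)((x^{-1}))$; and the Jacobi identity (J) below holds with $M=V$, $Y_M=Y_V$. Let $M=\coprod_{j\in\mathbb Q}M_{(j)}$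 be a $\mathbb Q$-graded vector space with $M_{(j)}=0$ for $j\ll 0$, and let $Y_M(x):M\to(V\otimes M)[[x,x^{-1}]]$ be a linear map, $Y_M(x)w=\sum_{k\in\mathbb Z}\Delta_k(w)x^{-k-1}$ with $\Delta_k(w)\in(V\otimes M)_{(j+k+1)}$ for $w\in M_{(j)}$. Suppose that for all $w\in M$ 1. (left counit) $(c\otimes Id_M)Y_M(x)w=w$; 2. (truncation) $Y_M(x)w\in(V\otimes M)((x^{-1}))$; and that 3. (weak coassociativity) for every $v'\in(V\otimes V\otimes M)'$ there is a nonnegative integer $k$ such that for all $w\in M$ $$(x_0+x_2)^k\langle v',(Y_V(x_0)\otimes Id_M)Y_M(x_2)w-(Id_V\otimes Y_M(x_2))Y_M(x_0+x_2)w\rangle=0 .$$ Then $M$ satisfies the Jacobi identity $$(\mathrm J)\quad x_0^{-1}\delta\Big(\frac{x_1-x_2}{x_0}\Big)(Id_V\otimes Y_M(x_2))Y_M(x_1)-x_0^{-1}\delta\Big(\frac{x_2-x_1}{-x_0}\Big)(T\otimes Id_M)(Id_V\otimes Y_M(x_1))Y_M(x_2)=x_2^{-1}\delta\Big(\frac{x_1-x_0}{x_2}\Big)(Y_V(x_0)\otimes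 Id_M)Y_M(x_2).$$ Moreover, with $D^*=Res_x\,x^{-2}(Id_V\otimes c)Y_V(x)$, the map $Y_M$ satisfies $$(e^{x_0D^*}\otimes Id_M)Y_M(x_2)=Y_M(x_2+x_0).$$ -/

import Mathlib

open scoped TensorProduct

namespace VertexCoalgebra

section FormalSeries

/-! Formal series in one, two or three variables, infinite in all directions, are
functions from the exponents (`ℤ`, `ℤ × ℤ`, `ℤ × ℤ × ℤ`) to the coefficients. -/

variable (F : Type*) [Field F]

/-- The coefficient of `y ^ e.1 * z ^ e.2` in `(y + ε z) ^ n`, `n ∈ ℤ`, expanded in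
nonnegative powers of the second variable `z`. -/
def binomExp (ε : F) (n : ℤ) (e : ℤ × ℤ) : F :=
  if 0 ≤ e.2 ∧ e.1 + e.2 = n then ((Ring.choose n e.2.toNat : ℤ) : F) * ε ^ e.2.toNat else 0

variable {F} {W : Type*} [AddCommGroup W] [Module F W]

/-- Multiplication of a vector-valued formal series by a scalar-valued one. It is only used
where each coefficient is a finite sum. -/
noncomputable def cauchyMul {G : Type*} [AddCommGroup G] (f : G → F) (g : G → W) : G → W :=
  fun e => ∑ᶠ d : G, f d • g (e - d)

/-- The series `f(y + z)`, expanded in nonnegative powers of `z`; the exponents are those of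
`(y, z)`. -/
noncomputable def substAdd (f : ℤ → W) : ℤ × ℤ → W :=
  fun e => ∑ᶠ n : ℤ, binomExp F 1 n e • f n

variable (F)

/-- `x₀⁻¹ δ((x₁ - x₂) / x₀) = ∑ₙ (x₁ - x₂)ⁿ x₀⁻ⁿ⁻¹`; exponents are those of `(x₀, x₁, x₂)`. -/
def delta₁ (e : ℤ × ℤ × ℤ) : F :=
  binomExp F (-1) (-e.1 - 1) (e.2.1, e.2.2)

/-- `x₀⁻¹ δ((x₂ - x₁) / (-x₀)) = ∑ₙ (-1)ⁿ (x₂ - x₁)ⁿ x₀⁻ⁿ⁻¹`; exponents are those of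
`(x₀, x₁, x₂)`. -/
def delta₂ (e : ℤ × ℤ × ℤ) : F :=
  (-1 : F) ^ (-e.1 - 1) * binomExp F (-1) (-e.1 - 1) (e.2.2, e.2.1)

/-- `x₂⁻¹ δ((x₁ - x₀) / x₂) = ∑ₙ (x₁ - x₀)ⁿ x₂⁻ⁿ⁻¹`; exponents are those of `(x₀, x₁, x₂)`. -/
def delta₃ (e : ℤ × ℤ × ℤ) : F :=
  binomExp F (-1) (-e.2.2 - 1) (e.2.1, e.1)

end FormalSeries

section Axioms

variable {F : Type*} [Field F] {V : Type*} [AddCommGroup V] [Module F V]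
  {M : Type*} [AddCommGroup M] [Module F M]

/-- For a linear map `Y(x) : M → (V ⊗ M)[[x, x⁻¹]]`, the coefficient of `x ^ n` as a linear map
`M → V ⊗ M`. -/
def coeff (Y : M →ₗ[F] (ℤ → V ⊗[F] M)) (n : ℤ) : M →ₗ[F] V ⊗[F] M :=
  LinearMap.proj n ∘ₗ Y

/-- The operator `Δ_k` in `Y(x) = ∑_k Δ_k x ^ (-k-1)`. -/
def comult (Y : M →ₗ[F] (ℤ → V ⊗[F] M)) (k : ℤ) : M →ₗ[F] V ⊗[F] M :=
  coeff Y (-k - 1)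

/-- `c ⊗ Id_M`, with values in `M`. -/
def counitLeft (M : Type*) [AddCommGroup M] [Module F M] (c : V →ₗ[F] F) :
    V ⊗[F] M →ₗ[F] M :=
  (TensorProduct.lid F M).toLinearMap ∘ₗ LinearMap.rTensor M c

/-- `Id_V ⊗ c`, with values in `V`. -/
def counitRight (c : V →ₗ[F] F) : V ⊗[F] V →ₗ[F] V :=
  (TensorProduct.rid F V).toLinearMap ∘ₗ LinearMap.lTensor V c

/-- Left counit axiom: `(c ⊗ Id_M) Y(x) w = w`. -/
def LeftCounit (c : V →ₗ[F] F) (YM : M →ₗ[F] (ℤ → V ⊗[F] M)) : Prop :=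
  ∀ (w : M) (n : ℤ), counitLeft M c (YM w n) = if n = 0 then w else 0

/-- Cocreation axiom: `(Id_V ⊗ c) Y(x) v ∈ V[[x]]`, with constant term `v`. -/
def Cocreation (c : V →ₗ[F] F) (Y : V →ₗ[F] (ℤ → V ⊗[F] V)) : Prop :=
  ∀ v : V, (∀ n : ℤ, n < 0 → counitRight c (Y v n) = 0) ∧ counitRight c (Y v 0) = v

/-- Truncation axiom: `Y(x) w ∈ (V ⊗ M)((x⁻¹))`. -/
def Truncation (YM : M →ₗ[F] (ℤ → V ⊗[F] M)) : Prop :=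
  ∀ w : M, ∃ N : ℤ, ∀ n : ℤ, N < n → YM w n = 0

/-- `(Id_V ⊗ Y_M(z)) Y_M(y) w`; exponents are those of `(y, z)`. -/
def iterRight (YM : M →ₗ[F] (ℤ → V ⊗[F] M)) (w : M) (e : ℤ × ℤ) : V ⊗[F] (V ⊗[F] M) :=
  LinearMap.lTensor V (coeff YM e.2) (YM w e.1)

/-- `(Y_V(y) ⊗ Id_M) Y_M(z) w`, in `V ⊗ V ⊗ M` bracketed to the right; exponents are those of
`(y, z)`. -/
def iterLeft (YV : V →ₗ[F] (ℤ → V ⊗[F] V)) (YM : M →ₗ[F] (ℤ → V ⊗[F] M)) (w : M)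
    (e : ℤ × ℤ) : V ⊗[F] (V ⊗[F] M) :=
  TensorProduct.assoc F V V M (LinearMap.rTensor M (coeff YV e.1) (YM w e.2))

/-- `(Id_V ⊗ Y_M(z)) Y_M(y + z) w`, with `Y_M(y + z)` expanded in nonnegative powers of `z`;
exponents are those of `(y, z)`. -/
noncomputable def iterRightShift (YM : M →ₗ[F] (ℤ → V ⊗[F] M)) (w : M) (e : ℤ × ℤ) :
    V ⊗[F] (V ⊗[F] M) :=
  ∑ᶠ i : ℤ, LinearMap.lTensor V (coeff YM (e.2 - i)) (substAdd (F := F) (YM w) (e.1, i))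

/-- The Jacobi identity. Exponents are those of `(x₀, x₁, x₂)`, and
`TensorProduct.leftComm` is `T ⊗ Id_M`. -/
def JacobiIdentity (YV : V →ₗ[F] (ℤ → V ⊗[F] V)) (YM : M →ₗ[F] (ℤ → V ⊗[F] M)) : Prop :=
  ∀ w : M,
    cauchyMul (delta₁ F)
        (fun e : ℤ × ℤ × ℤ => if e.1 = 0 then iterRight YM w (e.2.1, e.2.2) else 0) -
      cauchyMul (delta₂ F)
        (fun e : ℤ × ℤ × ℤ => if e.1 = 0 then
          TensorProduct.leftComm F V V M (iterRight YM w (e.2.2, e.2.1)) else 0) =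
    cauchyMul (delta₃ F)
        (fun e : ℤ × ℤ × ℤ => if e.2.1 = 0 then iterLeft YV YM w (e.1, e.2.2) else 0)

/-- Vertex coalgebras `(V, Y, c)`. -/
structure IsVertexCoalgebra (Y : V →ₗ[F] (ℤ → V ⊗[F] V)) (c : V →ₗ[F] F) : Prop where
  leftCounit : LeftCounit c Y
  cocreation : Cocreation c Y
  truncation : Truncation Y
  jacobi : JacobiIdentity Y Y

/-- `D* = Res_x x⁻² (Id_V ⊗ c) Y(x)`, the coefficient of `x` in `(Id_V ⊗ c) Y(x)`. -/
def Dstar (Y : V →ₗ[F] (ℤ → V ⊗[F] V)) (c : V →ₗ[F] F) : V →ₗ[F] V :=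
  counitRight c ∘ₗ coeff Y 1

/-- `(e ^ (z D) ⊗ Id_M) Y_M(y) w` for a linear map `D : V → V`; exponents are those of
`(y, z)`. -/
noncomputable def expTensor (D : V →ₗ[F] V) (YM : M →ₗ[F] (ℤ → V ⊗[F] M)) (w : M)
    (e : ℤ × ℤ) : V ⊗[F] M :=
  if 0 ≤ e.2 then
    ((e.2.toNat.factorial : F)⁻¹) • LinearMap.rTensor M (D ^ e.2.toNat) (YM w e.1)
  else 0

end Axioms

section Graded

variable {F : Type*} [Field F] {V : Type*} [AddCommGroup V] [Module F V]
  {M : Type*} [AddCommGroup M] [Module F M] {ι : Type*}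

/-- The weight spaces of `V ⊗ M`, for a `ℤ`-graded `V` and an `ι`-graded `M`
(here `ι` is `ℤ` or `ℚ`). -/
def tensorGrading [AddGroupWithOne ι] (𝒱 : ℤ → Submodule F V) (ℳ : ι → Submodule F M) (k : ι) :
    Submodule F (V ⊗[F] M) :=
  ⨆ (i : ℤ) (j : ι) (_ : (i : ι) + j = k),
    Submodule.map₂ (TensorProduct.mk F V M) (𝒱 i) (ℳ j)

/-- The graded dual `∐ₖ Hom(M₍ₖ₎, F)` as the space of linear functionals on
`M` that vanish on all but finitely many weight spaces. -/
def gradedDual (ℳ : ι → Submodule F M) : Submodule F (Module.Dual F M) where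
  carrier := {φ | {k | ∃ m ∈ ℳ k, φ m ≠ 0}.Finite}
  zero_mem' := by simp
  add_mem' := by
    intro φ ψ hφ hψ
    refine (hφ.union hψ).subset ?_
    rintro k ⟨m, hm, h⟩
    by_cases h1 : φ m = 0
    · exact Or.inr ⟨m, hm, fun h2 => h (by simp [h1, h2])⟩
    · exact Or.inl ⟨m, hm, h1⟩
  smul_mem' := by
    intro a φ hφ
    refine Set.Finite.subset hφ ?_
    rintro k ⟨m, hm, h⟩
    exact ⟨m, hm, fun h1 => h (by simp [h1])⟩

/-- `M = ∐ₖ M₍ₖ₎`, with `M₍ₖ₎ = 0` for `k ≪ 0`. -/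
structure IsLowerBoundedGrading [DecidableEq ι] [LT ι] (ℳ : ι → Submodule F M) : Prop where
  isInternal : DirectSum.IsInternal ℳ
  lowerBounded : ∃ N : ι, ∀ k : ι, k < N → ℳ k = ⊥

/-- `Δ_k` maps `M₍ⱼ₎` to `(V ⊗ M)₍ⱼ₊ₖ₊₁₎`. -/
def IsGradedMap [AddGroupWithOne ι] (𝒱 : ℤ → Submodule F V) (ℳ : ι → Submodule F M)
    (YM : M →ₗ[F] (ℤ → V ⊗[F] M)) : Prop :=
  ∀ (j : ι) (k : ℤ), ∀ w ∈ ℳ j, comult YM k w ∈ tensorGrading 𝒱 ℳ (j + (k : ι) + 1)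

/-- Graded vertex coalgebras. -/
structure IsGradedVertexCoalgebra (𝒱 : ℤ → Submodule F V) (Y : V →ₗ[F] (ℤ → V ⊗[F] V))
    (c : V →ₗ[F] F) : Prop extends IsVertexCoalgebra Y c where
  grading : IsLowerBoundedGrading 𝒱
  graded : IsGradedMap 𝒱 𝒱 Y

/-- A `ℚ`-graded vector space `M` with a map `Y_M` that satisfies all the axioms of a comodule
over the graded vertex coalgebra `(V, Y_V, c)` except the Jacobi identity. -/
structure IsGradedPrecomodule (𝒱 : ℤ → Submodule F V) (c : V →ₗ[F] F) (ℳ : ℚ → Submodule F M)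
    (YM : M →ₗ[F] (ℤ → V ⊗[F] M)) : Prop where
  leftCounit : LeftCounit c YM
  truncation : Truncation YM
  grading : IsLowerBoundedGrading ℳ
  graded : IsGradedMap 𝒱 ℳ YM

/-- Weak coassociativity: for each `v' ∈ (V ⊗ V ⊗ M)'` there is `k`, independent of `w`, with
`(x₀ + x₂)ᵏ ⟨v', (Y_V(x₀) ⊗ Id) Y_M(x₂) w - (Id ⊗ Y_M(x₂)) Y_M(x₀ + x₂) w⟩ = 0`. -/
def WeakCoassociativity (𝒱 : ℤ → Submodule F V) (YV : V →ₗ[F] (ℤ → V ⊗[F] V))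
    (ℳ : ℚ → Submodule F M) (YM : M →ₗ[F] (ℤ → V ⊗[F] M)) : Prop :=
  ∀ v' ∈ gradedDual (tensorGrading 𝒱 (tensorGrading 𝒱 ℳ)), ∃ k : ℕ, ∀ w : M,
    cauchyMul (binomExp F 1 (k : ℤ))
      (fun e : ℤ × ℤ => v' (iterLeft YV YM w e - iterRightShift YM w e)) = 0

end Graded

end VertexCoalgebra

/-! Each of the three terms of the Jacobi identity is a series in `x₀, x₁, x₂` annihilated by
`x₀ - x₁ + x₂`, and such a series vanishes as soon as the exponents of `x₁` and of `x₂` are both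
bounded below on its support. Paired with a functional in the graded dual, the first term minus
the right-hand side is bounded below in `x₁` by weak coassociativity, and the second term is so
because of the gradings. The involution `T` combined with `(x₀, x₁, x₂) ↦ (-x₀, x₂, x₁)` exchanges
the two terms on the left. It also fixes the right-hand side, by skew symmetry of `V` and
`((Id_V ⊗ c) Y_V(z) ⊗ Id_M) Y_M(y) = Y_M(y + z)`, so the defect is bounded below in `x₂` as well.
The formula for `Y_M(y + z)` comes from applying `c` to the middle factor in weak coassociativity,
by a similar vanishing argument, and `(Id_V ⊗ c) Y_V(z) = e ^ (z D*)`. -/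

namespace VertexCoalgebra

open Filter

section BinomialProducts

variable {F : Type*} [Field F] {W : Type*} [AddCommGroup W] [Module F W]
  {W' : Type*} [AddCommGroup W'] [Module F W']

theorem finsum_eq_finsum_comp {α β N : Type*} [AddCommMonoid N] {h : α → β}
    (hinj : Function.Injective h) {f : β → N} (hf : ∀ y, y ∉ Set.range h → f y = 0) :
    ∑ᶠ y, f y = ∑ᶠ i, f (h i) := by
  rw [← finsum_mem_range hinj, ← finsum_mem_univ]
  exact finsum_mem_inter_support_eq' f _ _ fun y hy =>
    iff_of_true trivial (by_contra fun h' => hy (hf y h'))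

theorem cauchyMul_comp_equiv {A B : Type*} [AddCommGroup A] [AddCommGroup B] (σ : A ≃+ B)
    (f : B → F) (g : B → W) (e : A) :
    cauchyMul (f ∘ σ) (g ∘ σ) e = cauchyMul f g (σ e) := by
  simp only [cauchyMul, Function.comp_apply, map_sub]
  exact finsum_comp_equiv σ.toEquiv (f := fun d => f d • g (σ e - d))

theorem cauchyMul_ite_fst {A B : Type*} [AddCommGroup A] [DecidableEq A] [AddCommGroup B]
    (f : A × B → F) (g : B → W) (a : A) (b : B) :
    cauchyMul f (fun e => if e.1 = 0 then g e.2 else 0) (a, b) =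
      cauchyMul (fun s => f (a, s)) g b := by
  rw [cauchyMul, cauchyMul, finsum_eq_finsum_comp (Prod.mk_right_injective a)]
  · simp
  · rintro ⟨x, s⟩ hx
    have hax : a - x ≠ 0 := fun h => hx ⟨s, by rw [sub_eq_zero.1 h]⟩
    simp [hax]

theorem choose_neg_sub_one (n : ℤ) (i : ℕ) :
    ((Ring.choose (-n - 1) i : ℤ) : F) = ((Ring.choose (n + i) i : ℤ) : F) * (-1) ^ i := by
  rw [show -n - 1 = -(n + 1) by ring, Ring.choose_neg, show n + 1 + (i : ℤ) - 1 = n + i by ring,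
    Int.negOnePow_def]
  simp [Units.smul_def, mul_comm]

/-- `z⁻¹ δ((y - x) / z) = y⁻¹ δ((z + x) / y)`. -/
theorem binomExp_neg_one_neg_sub_one (x y z : ℤ) :
    binomExp F (-1) (-z - 1) (y, x) = binomExp F 1 (-y - 1) (z, x) := by
  simp only [binomExp]
  by_cases h : 0 ≤ x ∧ y + x = -z - 1
  · rw [if_pos h, if_pos (by omega), show -z - 1 = y + (x.toNat : ℤ) by omega,
      choose_neg_sub_one y, one_pow, mul_one]
  · rw [if_neg h, if_neg (by omega)]

theorem cauchyMul_binomExp (ε : F) (n : ℤ) (G : ℤ × ℤ → W) (b d : ℤ) :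
    cauchyMul (binomExp F ε n) G (b, d) =
      ∑ᶠ i : ℕ, (((Ring.choose n i : ℤ) : F) * ε ^ i) • G (b - n + i, d - i) := by
  rw [cauchyMul, finsum_eq_finsum_comp (h := fun i : ℕ => (n - (i : ℤ), (i : ℤ)))]
  · refine finsum_congr fun i => ?_
    simp [binomExp, sub_add]
  · intro i j hij
    simpa using (Prod.mk.inj hij).2
  · rintro ⟨p, q⟩ hpq
    rw [binomExp, if_neg, zero_smul]
    rintro ⟨hq, hsum⟩
    refine hpq ⟨q.toNat, Prod.ext ?_ ?_⟩ <;> dsimp only at hq hsum ⊢ <;> omega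

theorem cauchyMul_binomExp_zero (ε : F) (G : ℤ × ℤ → W) :
    cauchyMul (binomExp F ε 0) G = G := by
  ext ⟨b, d⟩
  rw [cauchyMul_binomExp, finsum_eq_single _ 0]
  · simp
  · intro i hi
    obtain ⟨i, rfl⟩ := Nat.exists_eq_succ_of_ne_zero hi
    simp [Ring.choose_zero_succ]

variable (F) in
/-- The product of `(y + ε z) ^ n` with the series `G(y, z)` is well defined: each of its
coefficients is a finite sum. -/
def BinomSummable (n : ℤ) (G : ℤ × ℤ → W) : Prop :=
  ∀ b d : ℤ, ∀ᶠ i : ℕ in atTop, ((Ring.choose n i : ℤ) : F) • G (b + i, d - i) = 0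

/-- The exponents of the first variable of the series `G` are bounded above. -/
def TruncatedFst (G : ℤ × ℤ → W) : Prop := ∃ N : ℤ, ∀ e : ℤ × ℤ, N < e.1 → G e = 0

theorem TruncatedFst.map {G : ℤ × ℤ → W} (hG : TruncatedFst G) (φ : W →ₗ[F] W') :
    TruncatedFst (φ ∘ G) := by
  obtain ⟨N, hN⟩ := hG
  exact ⟨N, fun e he => by simp [hN e he]⟩

theorem TruncatedFst.binomSummable {G : ℤ × ℤ → W} (hG : TruncatedFst G) (n : ℤ) :
    BinomSummable F n G := by
  obtain ⟨N, hN⟩ := hG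
  intro b d
  filter_upwards [eventually_gt_atTop (N - b).toNat] with i hi
  rw [hN _ (by dsimp only; omega), smul_zero]

theorem binomSummable_natCast (n : ℕ) (G : ℤ × ℤ → W) : BinomSummable F n G := by
  intro b d
  filter_upwards [eventually_gt_atTop n] with i hi
  rw [Ring.choose_natCast, Nat.choose_eq_zero_of_lt hi]
  simp

theorem BinomSummable.eventually_eq_sum {n : ℤ} {G : ℤ × ℤ → W} (hG : BinomSummable F n G)
    (ε : F) (b d : ℤ) : ∀ᶠ m : ℕ in atTop, cauchyMul (binomExp F ε n) G (b, d) =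
      ∑ i ∈ Finset.range m, (((Ring.choose n i : ℤ) : F) * ε ^ i) • G (b - n + i, d - i) := by
  obtain ⟨m₀, hm₀⟩ := eventually_atTop.1 (hG (b - n) d)
  filter_upwards [eventually_ge_atTop m₀] with m hm
  rw [cauchyMul_binomExp]
  refine finsum_eq_sum_of_support_subset _ fun i hi => ?_
  by_contra him
  refine hi ?_
  dsimp only
  rw [mul_comm, mul_smul, hm₀ i (hm.trans (by simpa using him)), smul_zero]

theorem BinomSummable.map_cauchyMul {n : ℤ} {G : ℤ × ℤ → W} (hG : BinomSummable F n G)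
    (φ : W →ₗ[F] W') (ε : F) (e : ℤ × ℤ) :
    φ (cauchyMul (binomExp F ε n) G e) = cauchyMul (binomExp F ε n) (φ ∘ G) e := by
  have hφG : BinomSummable F n (φ ∘ G) := fun b d =>
    (hG b d).mono fun i hi => by rw [Function.comp_apply, ← map_smul, hi, map_zero]
  obtain ⟨m, h₁, h₂⟩ :=
    ((hG.eventually_eq_sum ε e.1 e.2).and (hφG.eventually_eq_sum ε e.1 e.2)).exists
  rw [h₁, h₂]
  simp only [map_sum, map_smul, Function.comp_apply]

theorem cauchyMul_binomExp_add_one (ε : F) {n : ℤ} {G : ℤ × ℤ → W}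
    (hG : BinomSummable F n G) (hG' : BinomSummable F (n + 1) G) (b d : ℤ) :
    cauchyMul (binomExp F ε (n + 1)) G (b, d) =
      cauchyMul (binomExp F ε n) G (b - 1, d) + ε • cauchyMul (binomExp F ε n) G (b, d - 1) := by
  have hshift : Tendsto (fun m : ℕ => m + 1) atTop atTop := tendsto_add_atTop_nat 1
  obtain ⟨m, h₁, h₂, h₃⟩ := ((hshift.eventually (hG'.eventually_eq_sum ε b d)).and
    ((hshift.eventually (hG.eventually_eq_sum ε (b - 1) d)).and
      (hG.eventually_eq_sum ε b (d - 1)))).exists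
  rw [h₁, h₂, h₃, Finset.sum_range_succ', Finset.sum_range_succ', Finset.smul_sum, add_right_comm,
    ← Finset.sum_add_distrib]
  congr 1
  · refine Finset.sum_congr rfl fun i _ => ?_
    rw [Ring.choose_succ_succ, smul_smul,
      show b - (n + 1) + ((i + 1 : ℕ) : ℤ) = b - n + i by push_cast; ring,
      show b - 1 - n + ((i + 1 : ℕ) : ℤ) = b - n + i by push_cast; ring,
      show d - ((i + 1 : ℕ) : ℤ) = d - 1 - i by push_cast; ring, ← add_smul]
    congr 1
    push_cast
    ring
  · simp only [Ring.choose_zero_right, Nat.cast_zero, add_zero, sub_add_eq_sub_sub_swap]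

theorem substAdd_apply (f : ℤ → W) (a d : ℤ) :
    substAdd (F := F) f (a, d) =
      if 0 ≤ d then ((Ring.choose (a + d) d.toNat : ℤ) : F) • f (a + d) else 0 := by
  rw [substAdd, finsum_eq_single _ (a + d)]
  · simp only [binomExp, and_true, one_pow, mul_one]
    split_ifs <;> simp
  · intro n hn
    rw [binomExp, if_neg (fun h => hn h.2.symm), zero_smul]

theorem map_substAdd (φ : W →ₗ[F] W') (f : ℤ → W) (e : ℤ × ℤ) :
    φ (substAdd (F := F) f e) = substAdd (F := F) (φ ∘ f) e := by
  obtain ⟨a, d⟩ := e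
  simp only [substAdd_apply, apply_ite φ, map_smul, map_zero, Function.comp_apply]

/-- For `n ≥ 0` the two expansions of `(y + z) ^ n` agree. -/
theorem substAdd_swap {f : ℤ → W} (hf : ∀ n < 0, f n = 0) (a d : ℤ) :
    substAdd (F := F) f (a, d) = substAdd (F := F) f (d, a) := by
  rw [substAdd_apply, substAdd_apply, add_comm d a]
  rcases lt_or_ge (a + d) 0 with h | h
  · simp [hf _ h]
  obtain ⟨n, hn⟩ := Int.eq_ofNat_of_zero_le h
  have choose_symm : (if 0 ≤ d then n.choose d.toNat else 0) =
      if 0 ≤ a then n.choose a.toNat else 0 := by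
    split_ifs
    · exact Nat.choose_symm_of_eq_add (by omega)
    · exact Nat.choose_eq_zero_of_lt (by omega)
    · exact (Nat.choose_eq_zero_of_lt (by omega)).symm
    · rfl
  have := congrArg (fun k : ℕ => (k : F) • f n) choose_symm
  simpa only [hn, Ring.choose_natCast, Int.cast_natCast, apply_ite (Nat.cast (R := F)), ite_smul,
    Nat.cast_zero, zero_smul] using this

end BinomialProducts

section DeltaSeries

variable {F : Type*} [Field F] {W : Type*} [AddCommGroup W] [Module F W]
  {W' : Type*} [AddCommGroup W'] [Module F W']

theorem neg_one_zpow_mul_self (a : ℤ) : (-1 : F) ^ a * (-1 : F) ^ a = 1 := by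
  rw [← mul_zpow]; simp

theorem neg_one_zpow_neg_sub_one (a : ℤ) : (-1 : F) ^ (-a - 1) = -(-1 : F) ^ a := by
  rw [zpow_sub_one₀ (by simp), zpow_neg, ← inv_zpow]
  simp

/-- The coefficient of `x ^ a * y ^ b * z ^ d` in `x⁻¹ δ((y + ε z) / x) G(y, z)`. -/
noncomputable def deltaMul (ε : F) (G : ℤ × ℤ → W) (a b d : ℤ) : W :=
  cauchyMul (binomExp F ε (-a - 1)) G (b, d)

theorem deltaMul_neg_one (ε : F) (G : ℤ × ℤ → W) (b d : ℤ) : deltaMul ε G (-1) b d = G (b, d) := by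
  rw [deltaMul, show -(-1 : ℤ) - 1 = 0 by ring, cauchyMul_binomExp_zero]

theorem map_deltaMul (φ : W →ₗ[F] W') (ε : F) {G : ℤ × ℤ → W} (hG : TruncatedFst G)
    (a b d : ℤ) : φ (deltaMul ε G a b d) = deltaMul ε (φ ∘ G) a b d :=
  (hG.binomSummable _).map_cauchyMul φ ε _

theorem deltaMul_eq_zero_of_le (ε : F) {G : ℤ × ℤ → W} {K : ℤ}
    (hK : ∀ e : ℤ × ℤ, e.2 ≤ K → G e = 0) (a b : ℤ) {d : ℤ} (hd : d ≤ K) :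
    deltaMul ε G a b d = 0 := by
  rw [deltaMul, cauchyMul_binomExp]
  refine (finsum_congr fun i => ?_).trans finsum_zero
  rw [hK _ (by dsimp only; omega), smul_zero]

/-- `x⁻¹ δ((y - z) / x) f(y) = y⁻¹ δ((x + z) / y) f(x + z)`. -/
theorem deltaMul_neg_one_ite_snd (f : ℤ → W) (a b d : ℤ) :
    deltaMul (-1 : F) (fun e => if e.2 = 0 then f e.1 else 0) a b d =
      substAdd (F := F) (fun n => f (n + b + 1)) (a, d) := by
  rw [deltaMul, cauchyMul, substAdd,
    finsum_eq_finsum_comp (h := fun n : ℤ => (-n - 1, d))]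
  · refine finsum_congr fun n => ?_
    rw [binomExp_neg_one_neg_sub_one d (-n - 1) a, Prod.mk_sub_mk, sub_self, if_pos rfl]
    congr 2 <;> ring
  · intro m n hmn
    simpa using hmn
  · rintro ⟨p, q⟩ hpq
    have hq : d - q ≠ 0 := fun h => hpq ⟨-p - 1, by rw [sub_eq_zero.1 h]; simp⟩
    simp [hq]

/-- The series `X` in `x, y, z` is annihilated by `x - y + z`. -/
def IsDeltaSeries (X : ℤ → ℤ → ℤ → W) : Prop :=
  ∀ a b d : ℤ, X (a - 1) b d = X a (b - 1) d - X a b (d - 1)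

namespace IsDeltaSeries

variable {X Z : ℤ → ℤ → ℤ → W}

theorem add (hX : IsDeltaSeries X) (hZ : IsDeltaSeries Z) : IsDeltaSeries (X + Z) := by
  intro a b d
  simp only [Pi.add_apply, hX a b d, hZ a b d]
  abel

theorem sub (hX : IsDeltaSeries X) (hZ : IsDeltaSeries Z) : IsDeltaSeries (X - Z) := by
  intro a b d
  simp only [Pi.sub_apply, hX a b d, hZ a b d]
  abel

theorem map (hX : IsDeltaSeries X) (φ : W →ₗ[F] W') :
    IsDeltaSeries fun a b d => φ (X a b d) := by
  intro a b d
  simp only [hX a b d, map_sub]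

theorem reverse (hX : IsDeltaSeries X) : IsDeltaSeries fun a b d => X d b a := by
  intro a b d
  simp only [hX d b a, sub_sub_cancel]

theorem eq_zero_of_le (hX : IsDeltaSeries X) {K : ℤ} (h : ∀ a d, X a K d = 0) (a : ℤ) {b : ℤ}
    (hb : b ≤ K) (d : ℤ) : X a b d = 0 := by
  induction b, hb using Int.leInductionDown generalizing a d with
  | base => exact h a d
  | pred b _ ih => rw [← sub_add_cancel (X a (b - 1) d) (X a b (d - 1)), ← hX, ih, ih, add_zero]

theorem eq_zero (hX : IsDeltaSeries X) {K : ℤ} (hb : ∀ a b d, b ≤ K → X a b d = 0)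
    (hd : ∀ a b d, d ≤ K → X a b d = 0) : X = 0 := by
  have eq_zero_of_add_le (n : ℕ) : ∀ a b d, b + d ≤ 2 * K + n → X a b d = 0 := by
    induction n with
    | zero =>
      intro a b d h
      rcases le_or_gt b K with h' | h'
      · exact hb a b d h'
      · exact hd a b d (by omega)
    | succ n ih =>
      intro a b d h
      have h1 := hX (a + 1) b d
      rw [add_sub_cancel_right] at h1
      rw [h1, ih _ _ _ (by omega), ih _ _ _ (by omega), sub_zero]
  ext a b d
  exact eq_zero_of_add_le (b + d - 2 * K).toNat a b d (by omega)

theorem apply_sub_natCast (hX : IsDeltaSeries X) (k : ℕ) (a b d : ℤ) :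
    X a (b - k) d = cauchyMul (binomExp F 1 k) (fun e => X e.1 b e.2) (a, d) := by
  induction k generalizing a d with
  | zero => simp [cauchyMul_binomExp_zero]
  | succ k ih =>
    have hsum := binomSummable_natCast (F := F) (k + 1) fun e => X e.1 b e.2
    rw [Nat.cast_succ] at hsum ⊢
    rw [cauchyMul_binomExp_add_one 1 (binomSummable_natCast k _) hsum, one_smul, ← ih, ← ih, hX,
      sub_add_cancel, sub_sub]

end IsDeltaSeries

theorem deltaMul_sub_one (ε : F) {G : ℤ × ℤ → W} (hG : TruncatedFst G) (a b d : ℤ) :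
    deltaMul ε G (a - 1) b d = deltaMul ε G a (b - 1) d + ε • deltaMul ε G a b (d - 1) := by
  rw [deltaMul, show -(a - 1) - 1 = -a - 1 + 1 by ring]
  exact cauchyMul_binomExp_add_one ε (hG.binomSummable _) (hG.binomSummable _) b d

theorem isDeltaSeries_deltaMul {G : ℤ × ℤ → W} (hG : TruncatedFst G) :
    IsDeltaSeries (deltaMul (-1 : F) G) := by
  intro a b d
  rw [deltaMul_sub_one _ hG, neg_one_smul, ← sub_eq_add_neg]

theorem isDeltaSeries_deltaMul_rotate {G : ℤ × ℤ → W} (hG : TruncatedFst G) :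
    IsDeltaSeries fun a b d => deltaMul (1 : F) G b d a := by
  intro a b d
  simp only [deltaMul_sub_one _ hG b d a, one_smul, add_sub_cancel_left]

/-- Both sides extend to series annihilated by `x - y + z` that vanish for negative exponents
of `z`; `h` says that they agree for low exponents of `y`, up to the symmetry of `f(x + z)`. -/
theorem eq_substAdd_of_deltaMul_eq {f : ℤ → W} {g : ℤ × ℤ → W} {K N : ℤ}
    (hfN : ∀ n, N < n → f n = 0) (hfK : ∀ n ≤ K, f n = 0) (hg : TruncatedFst g)
    (hg_neg : ∀ e : ℤ × ℤ, e.2 < 0 → g e = 0)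
    (h : ∀ a b d, b ≤ K →
      substAdd (F := F) (fun n => f (n + b + 1)) (a, d) = deltaMul (1 : F) g b d a) :
    g = substAdd (F := F) f := by
  have hf : TruncatedFst fun e : ℤ × ℤ => if e.2 = 0 then f e.1 else 0 :=
    ⟨N, fun e he => by simp [hfN _ he]⟩
  have hX := (isDeltaSeries_deltaMul (F := F) hf).sub
    (isDeltaSeries_deltaMul_rotate (F := F) hg).reverse
  have eq_zero := hX.eq_zero (K := min K (-1)) ?_ ?_
  · ext ⟨d, a⟩
    have := congrFun₃ eq_zero d (-1) a
    refine (sub_eq_zero.1 (Eq.trans ?_ this)).symm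
    simp [deltaMul_neg_one_ite_snd, deltaMul_neg_one]
  · intro d b a hb
    have hfb : ∀ n < 0, f (n + b + 1) = 0 := fun n hn => hfK _ (by omega)
    simp only [Pi.sub_apply]
    rw [deltaMul_neg_one_ite_snd, substAdd_swap hfb, h a b d (by omega), sub_self]
  · intro d b a ha
    simp only [Pi.sub_apply]
    rw [deltaMul_neg_one_ite_snd, substAdd_apply, if_neg (by omega),
      deltaMul_eq_zero_of_le (K := -1) 1 (fun e he => hg_neg e (by omega)) b d (by omega), sub_zero]

end DeltaSeries

section JacobiTerms

variable {F : Type*} [Field F] {V : Type*} [AddCommGroup V] [Module F V]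
  {M : Type*} [AddCommGroup M] [Module F M] {W : Type*} [AddCommGroup W] [Module F W]
  {YV : V →ₗ[F] (ℤ → V ⊗[F] V)} {YM : M →ₗ[F] (ℤ → V ⊗[F] M)}

theorem leftComm_leftComm (z : V ⊗[F] (V ⊗[F] M)) :
    TensorProduct.leftComm F V V M (TensorProduct.leftComm F V V M z) = z := by
  suffices h : (TensorProduct.leftComm F V V M).toLinearMap ∘ₗ
      (TensorProduct.leftComm F V V M).toLinearMap = LinearMap.id from LinearMap.congr_fun h z
  ext u v m
  simp

variable (F) in
/-- The involution `T ⊗ Id_M` combined with the substitution `(x₀, x₁, x₂) ↦ (-x₀, x₂, x₁)`, on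
series in `x₀, x₁, x₂` with coefficients in `V ⊗ V ⊗ M`. -/
def skewFlip : (ℤ → ℤ → ℤ → V ⊗[F] (V ⊗[F] M)) →ₗ[F] (ℤ → ℤ → ℤ → V ⊗[F] (V ⊗[F] M)) where
  toFun X a b d := (-1 : F) ^ a • TensorProduct.leftComm F V V M (X a d b)
  map_add' X Z := by ext; simp
  map_smul' r X := by ext a b d; simp [smul_comm r ((-1 : F) ^ a)]

theorem skewFlip_apply (X : ℤ → ℤ → ℤ → V ⊗[F] (V ⊗[F] M)) (a b d : ℤ) :
    skewFlip F X a b d = (-1 : F) ^ a • TensorProduct.leftComm F V V M (X a d b) := rfl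

theorem skewFlip_skewFlip (X : ℤ → ℤ → ℤ → V ⊗[F] (V ⊗[F] M)) : skewFlip F (skewFlip F X) = X := by
  ext a b d
  rw [skewFlip_apply, skewFlip_apply, map_smul, leftComm_leftComm, smul_smul,
    neg_one_zpow_mul_self, one_smul]

theorem IsDeltaSeries.skewFlip {X : ℤ → ℤ → ℤ → V ⊗[F] (V ⊗[F] M)} (hX : IsDeltaSeries X) :
    IsDeltaSeries (skewFlip F X) := by
  intro a b d
  simp only [skewFlip_apply, hX a d b, zpow_sub_one₀ (neg_ne_zero.2 (one_ne_zero (α := F))),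
    inv_neg, inv_one, mul_neg, mul_one, neg_smul, map_sub, smul_sub]
  abel

variable (YM) in
/-- `x₀⁻¹ δ((x₁ - x₂) / x₀) (Id_V ⊗ Y_M(x₂)) Y_M(x₁) w`. -/
noncomputable def jacobiRight (w : M) (a b d : ℤ) : V ⊗[F] (V ⊗[F] M) :=
  deltaMul (-1 : F) (iterRight YM w) a b d

variable (YV YM) in
/-- `x₂⁻¹ δ((x₁ - x₀) / x₂) (Y_V(x₀) ⊗ Id_M) Y_M(x₂) w`, where the delta function is written as
`x₁⁻¹ δ((x₂ + x₀) / x₁)`. -/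
noncomputable def jacobiLeft (w : M) (a b d : ℤ) : V ⊗[F] (V ⊗[F] M) :=
  deltaMul (1 : F) (iterLeft YV YM w ∘ Prod.swap) b d a

theorem cauchyMul_delta₁ (G : ℤ × ℤ → W) (a b d : ℤ) :
    cauchyMul (delta₁ F) (fun e => if e.1 = 0 then G (e.2.1, e.2.2) else 0) (a, b, d) =
      deltaMul (-1 : F) G a b d :=
  cauchyMul_ite_fst (delta₁ F) G a (b, d)

theorem cauchyMul_delta₂ (G : ℤ × ℤ → W) (a b d : ℤ) :
    cauchyMul (delta₂ F) (fun e => if e.1 = 0 then G (e.2.2, e.2.1) else 0) (a, b, d) =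
      -((-1 : F) ^ a • deltaMul (-1 : F) G a d b) := by
  refine (cauchyMul_ite_fst (delta₂ F) (G ∘ Prod.swap) a (b, d)).trans ?_
  rw [deltaMul, ← neg_smul, ← neg_one_zpow_neg_sub_one]
  refine Eq.trans ?_ (congrArg _ (cauchyMul_comp_equiv AddEquiv.prodComm _ G (b, d)))
  simp only [cauchyMul, smul_finsum, smul_smul]
  rfl

theorem cauchyMul_delta₃ (G : ℤ × ℤ → W) (a b d : ℤ) :
    cauchyMul (delta₃ F) (fun e => if e.2.1 = 0 then G (e.1, e.2.2) else 0) (a, b, d) =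
      deltaMul (1 : F) (G ∘ Prod.swap) b d a := by
  let σ : ℤ × ℤ × ℤ ≃+ ℤ × ℤ × ℤ := AddEquiv.prodComm.trans AddEquiv.prodAssoc
  have hδ : delta₃ F = (fun e : ℤ × ℤ × ℤ => binomExp F 1 (-e.1 - 1) e.2) ∘ σ :=
    funext fun e => binomExp_neg_one_neg_sub_one e.1 e.2.1 e.2.2
  rw [hδ]
  exact (cauchyMul_comp_equiv σ _ (fun e => if e.1 = 0 then (G ∘ Prod.swap) e.2 else 0) _).trans
    (cauchyMul_ite_fst _ _ b (d, a))

theorem Truncation.truncatedFst_iterRight (h : Truncation YM) (w : M) :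
    TruncatedFst (iterRight YM w) := by
  obtain ⟨N, hN⟩ := h w
  exact ⟨N, fun e he => by rw [iterRight, hN _ he, map_zero]⟩

theorem Truncation.truncatedFst_iterLeft_swap (h : Truncation YM) (w : M) :
    TruncatedFst (iterLeft YV YM w ∘ Prod.swap) := by
  obtain ⟨N, hN⟩ := h w
  exact ⟨N, fun e he => by simp [iterLeft, hN _ he]⟩

theorem Truncation.isDeltaSeries_jacobiRight (h : Truncation YM) (w : M) :
    IsDeltaSeries (jacobiRight YM w) :=
  isDeltaSeries_deltaMul (h.truncatedFst_iterRight w)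

theorem Truncation.isDeltaSeries_jacobiLeft (h : Truncation YM) (w : M) :
    IsDeltaSeries (jacobiLeft YV YM w) :=
  isDeltaSeries_deltaMul_rotate (h.truncatedFst_iterLeft_swap w)

theorem jacobiLeft_neg_one (w : M) (a d : ℤ) :
    jacobiLeft YV YM w a (-1) d = iterLeft YV YM w (a, d) :=
  deltaMul_neg_one _ _ _ _

theorem jacobiIdentity_iff (ht : Truncation YM) : JacobiIdentity YV YM ↔ ∀ w : M,
    jacobiRight YM w + skewFlip F (jacobiRight YM w) = jacobiLeft YV YM w := by
  refine forall_congr' fun w => ?_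
  simp only [funext_iff, Prod.forall]
  refine forall_congr' fun a => forall_congr' fun b => forall_congr' fun d => ?_
  have hflip : skewFlip F (jacobiRight YM w) a b d = (-1 : F) ^ a •
      deltaMul (-1 : F) (TensorProduct.leftComm F V V M ∘ iterRight YM w) a d b :=
    congrArg (fun z => (-1 : F) ^ a • z) <|
      map_deltaMul (F := F) (TensorProduct.leftComm F V V M).toLinearMap (-1)
        (ht.truncatedFst_iterRight w) a d b
  have hswap := cauchyMul_delta₂ (F := F) (TensorProduct.leftComm F V V M ∘ iterRight YM w) a b d
  simp only [Function.comp_apply] at hswap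
  rw [Pi.sub_apply, hswap, sub_neg_eq_add, ← hflip, cauchyMul_delta₁, cauchyMul_delta₃]
  rfl

theorem iterRightShift_eq_jacobiRight (w : M) (a d : ℤ) :
    iterRightShift YM w (a, d) = jacobiRight YM w a (-1) d := by
  rw [iterRightShift, jacobiRight, deltaMul, cauchyMul_binomExp,
    finsum_eq_finsum_comp (h := fun i : ℕ => (i : ℤ)) Nat.cast_injective]
  · refine finsum_congr fun i => ?_
    rw [substAdd_apply, if_pos (by omega), Int.toNat_natCast, choose_neg_sub_one, mul_assoc,
      ← mul_pow, map_smul]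
    simp only [mul_neg, mul_one, neg_neg, one_pow, iterRight]
    rw [show a + (i : ℤ) = -1 - (-a - 1) + i by ring]
  · intro i hi
    rw [substAdd_apply, if_neg fun h => hi ⟨i.toNat, by simp [h]⟩, map_zero]

/-- By `jacobiLeft_neg_one` and `iterRightShift_eq_jacobiRight`, weak coassociativity says that
the coefficients of `x₁ ^ (-1 - k)` in the two terms agree. -/
theorem map_jacobiRight_eq_map_jacobiLeft (ht : Truncation YM) (φ : V ⊗[F] (V ⊗[F] M) →ₗ[F] W)
    {w : M} {k : ℕ} (hk : cauchyMul (binomExp F 1 k)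
      (fun e => φ (iterLeft YV YM w e - iterRightShift YM w e)) = 0)
    (a : ℤ) {b : ℤ} (hb : b ≤ -1 - k) (d : ℤ) :
    φ (jacobiRight YM w a b d) = φ (jacobiLeft YV YM w a b d) := by
  have hX := ((ht.isDeltaSeries_jacobiLeft (YV := YV) w).sub (ht.isDeltaSeries_jacobiRight w)).map φ
  have eq_zero : φ (jacobiLeft YV YM w a b d - jacobiRight YM w a b d) = 0 := by
    refine hX.eq_zero_of_le (fun a d => ?_) a hb d
    rw [hX.apply_sub_natCast (F := F) k a (-1) d]
    simp only [Pi.sub_apply, jacobiLeft_neg_one, ← iterRightShift_eq_jacobiRight]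
    exact congrFun hk (a, d)
  rw [map_sub, sub_eq_zero] at eq_zero
  exact eq_zero.symm

end JacobiTerms

section Grading

variable {F : Type*} [Field F] {V : Type*} [AddCommGroup V] [Module F V]
  {M : Type*} [AddCommGroup M] [Module F M] {N : Type*} [AddCommGroup N] [Module F N]
  {P : Type*} [AddCommGroup P] [Module F P] {ι : Type*}

/-- The linear map `f` raises weights by `d`. -/
def HasWeight [Add ι] (ℳ : ι → Submodule F M) (𝒩 : ι → Submodule F N) (d : ι) (f : M →ₗ[F] N) :
    Prop :=
  ∀ k, ∀ m ∈ ℳ k, f m ∈ 𝒩 (k + d)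

theorem HasWeight.comp [AddSemigroup ι] {ℳ : ι → Submodule F M} {𝒩 : ι → Submodule F N}
    {𝒬 : ι → Submodule F P} {d e : ι} {g : N →ₗ[F] P} {f : M →ₗ[F] N} (hg : HasWeight 𝒩 𝒬 e g)
    (hf : HasWeight ℳ 𝒩 d f) : HasWeight ℳ 𝒬 (d + e) (g ∘ₗ f) := fun k m hm => by
  rw [← add_assoc]
  exact hg _ _ (hf k m hm)

theorem HasWeight.comp_mem_gradedDual [AddGroup ι] {ℳ : ι → Submodule F M}
    {𝒩 : ι → Submodule F N} {d : ι} {f : M →ₗ[F] N} (hf : HasWeight ℳ 𝒩 d f)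
    {φ : Module.Dual F N} (hφ : φ ∈ gradedDual 𝒩) : φ ∘ₗ f ∈ gradedDual ℳ := by
  refine (hφ.preimage (add_left_injective d).injOn).subset ?_
  rintro k ⟨m, hm, hne⟩
  exact ⟨f m, hf k m hm, hne⟩

theorem dualCoannihilator_gradedDual [DecidableEq ι] {ℳ : ι → Submodule F M}
    (hℳ : DirectSum.IsInternal ℳ) : (gradedDual ℳ).dualCoannihilator = ⊥ := by
  refine (Submodule.eq_bot_iff _).2 fun m hm => ?_
  rw [Submodule.mem_dualCoannihilator] at hm
  let b := hℳ.collectedBasis fun i => Module.Basis.ofVectorSpace F (ℳ i)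
  refine b.ext_elem fun i => ?_
  rw [map_zero, Finsupp.zero_apply]
  refine hm (b.coord i) ((Set.finite_singleton i.1).subset ?_)
  rintro k ⟨m, hm, hne⟩
  by_contra hk
  exact hne (hℳ.collectedBasis_repr_of_mem_ne _ hk hm)

section TensorGrading

variable [AddCommGroupWithOne ι] {𝒱 : ℤ → Submodule F V} {ℳ : ι → Submodule F M}
  {𝒩 : ι → Submodule F N}

theorem tmul_mem_tensorGrading {i : ℤ} {j : ι} {v : V} (hv : v ∈ 𝒱 i) {m : M} (hm : m ∈ ℳ j) :
    v ⊗ₜ[F] m ∈ tensorGrading 𝒱 ℳ (i + j) :=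
  Submodule.mem_iSup_of_mem i <| Submodule.mem_iSup_of_mem j <| Submodule.mem_iSup_of_mem rfl <|
    Submodule.apply_mem_map₂ (TensorProduct.mk F V M) hv hm

theorem tensorGrading_le {k : ι} {P : Submodule F (V ⊗[F] M)}
    (h : ∀ (i : ℤ) (j : ι), (i : ι) + j = k → ∀ v ∈ 𝒱 i, ∀ m ∈ ℳ j, v ⊗ₜ[F] m ∈ P) :
    tensorGrading 𝒱 ℳ k ≤ P :=
  iSup_le fun i => iSup_le fun j => iSup_le fun hij =>
    Submodule.map₂_le.2 fun v hv m hm => h i j hij v hv m hm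

theorem HasWeight.of_comp_mk {d : ι} {f : V ⊗[F] M →ₗ[F] N}
    (hf : ∀ i : ℤ, ∀ v ∈ 𝒱 i, HasWeight ℳ 𝒩 (i + d) (f ∘ₗ TensorProduct.mk F V M v)) :
    HasWeight (tensorGrading 𝒱 ℳ) 𝒩 d f := by
  intro k z hz
  suffices h : tensorGrading 𝒱 ℳ k ≤ (𝒩 (k + d)).comap f from h hz
  refine tensorGrading_le fun i j hij v hv m hm => ?_
  rw [Submodule.mem_comap, ← hij, add_comm (i : ι), add_assoc]
  exact hf i v hv j m hm

theorem hasWeight_mk {i : ℤ} {v : V} (hv : v ∈ 𝒱 i) :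
    HasWeight ℳ (tensorGrading 𝒱 ℳ) i (TensorProduct.mk F V M v) := fun j m hm => by
  rw [add_comm]
  exact tmul_mem_tensorGrading hv hm

theorem HasWeight.lTensor {d : ι} {f : M →ₗ[F] N} (hf : HasWeight ℳ 𝒩 d f) :
    HasWeight (tensorGrading 𝒱 ℳ) (tensorGrading 𝒱 𝒩) d (LinearMap.lTensor V f) := by
  refine .of_comp_mk fun i v hv => ?_
  rw [add_comm]
  exact (hasWeight_mk hv).comp hf

theorem hasWeight_leftComm :
    HasWeight (tensorGrading 𝒱 (tensorGrading 𝒱 ℳ)) (tensorGrading 𝒱 (tensorGrading 𝒱 ℳ)) 0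
      (TensorProduct.leftComm F V V M).toLinearMap := by
  refine .of_comp_mk fun i u hu => .of_comp_mk fun j v hv => ?_
  rw [add_zero, add_comm]
  exact (hasWeight_mk hv).comp (hasWeight_mk hu)

theorem hasWeight_counitLeft {r : ℤ} {c : V →ₗ[F] F} (hc : ∀ i ≠ r, ∀ v ∈ 𝒱 i, c v = 0) :
    HasWeight (tensorGrading 𝒱 ℳ) ℳ (-r) (counitLeft M c) := by
  refine .of_comp_mk fun i v hv j m hm => ?_
  rcases eq_or_ne i r with rfl | hi
  · rw [add_neg_cancel, add_zero]
    exact Submodule.smul_mem _ _ hm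
  · simp [counitLeft, hc i hi v hv]

theorem IsGradedMap.hasWeight_coeff {YM : M →ₗ[F] (ℤ → V ⊗[F] M)} (h : IsGradedMap 𝒱 ℳ YM)
    (n : ℤ) : HasWeight ℳ (tensorGrading 𝒱 ℳ) (-n) (coeff YM n) := by
  intro j w hw
  have hmem := h j (-n - 1) w hw
  rwa [comult, show -(-n - 1) - 1 = n by ring,
    show j + ((-n - 1 : ℤ) : ι) + 1 = j + -n by push_cast; abel] at hmem

theorem dualCoannihilator_gradedDual_tensorGrading (h𝒱 : DirectSum.IsInternal 𝒱)
    (hℳ : (gradedDual ℳ).dualCoannihilator = ⊥) :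
    (gradedDual (tensorGrading 𝒱 ℳ)).dualCoannihilator = ⊥ := by
  classical
  refine (Submodule.eq_bot_iff _).2 fun z hz => ?_
  rw [Submodule.mem_dualCoannihilator] at hz
  let b := h𝒱.collectedBasis fun i => Module.Basis.ofVectorSpace F (𝒱 i)
  refine (TensorProduct.equivFinsuppOfBasisLeft b).injective (Finsupp.ext fun i => ?_)
  rw [map_zero, Finsupp.zero_apply, TensorProduct.equivFinsuppOfBasisLeft_apply,
    ← Submodule.mem_bot F, ← hℳ, Submodule.mem_dualCoannihilator]
  exact fun ψ hψ => hz (ψ ∘ₗ counitLeft M (b.coord i)) <| (hasWeight_counitLeft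
    fun j hj v hv => h𝒱.collectedBasis_repr_of_mem_ne _ hj hv).comp_mem_gradedDual hψ

theorem exists_forall_le_apply_eq_zero [CharZero ι] (hℳ : ⨆ j, ℳ j = ⊤) {κ : Type*}
    {deg : κ → ℤ} {f : κ → M →ₗ[F] N} (hf : ∀ x, HasWeight ℳ 𝒩 (-deg x) (f x))
    {φ : Module.Dual F N} (hφ : φ ∈ gradedDual 𝒩) (w : M) :
    ∃ K, ∀ x, deg x ≤ K → φ (f x w) = 0 := by
  induction (hℳ ▸ Submodule.mem_top : w ∈ ⨆ j, ℳ j) using Submodule.iSup_induction' with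
  | zero => exact ⟨0, by simp⟩
  | add w w' _ _ hw hw' =>
    obtain ⟨K, hK⟩ := hw
    obtain ⟨K', hK'⟩ := hw'
    refine ⟨min K K', fun x hx => ?_⟩
    rw [map_add, map_add, hK x (by omega), hK' x (by omega), add_zero]
  | mem j w hw =>
    have hinj : Function.Injective fun n : ℤ => j + -(n : ι) :=
      (add_right_injective j).comp (neg_injective.comp Int.cast_injective)
    obtain ⟨B, hB⟩ := (hφ.preimage hinj.injOn).bddBelow
    refine ⟨B - 1, fun x hx => by_contra fun hne => ?_⟩
    have : B ≤ deg x := hB ⟨f x w, hf x j w hw, hne⟩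
    omega

end TensorGrading

theorem exists_eqOn_and_eq_zero {𝒱 : ι → Submodule F V} [DecidableEq ι]
    (h𝒱 : DirectSum.IsInternal 𝒱) (f : V →ₗ[F] N) (r : ι) :
    ∃ g : V →ₗ[F] N, (∀ v ∈ 𝒱 r, g v = f v) ∧ ∀ i ≠ r, ∀ v ∈ 𝒱 i, g v = 0 := by
  let := h𝒱.chooseDecomposition
  refine ⟨f ∘ₗ (𝒱 r).subtype ∘ₗ DirectSum.component F ι (fun i => 𝒱 i) r ∘ₗ
    (DirectSum.decomposeLinearEquiv 𝒱).toLinearMap, fun v hv => ?_, fun i hi v hv => ?_⟩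
  · exact congrArg f (DirectSum.decompose_of_mem_same 𝒱 hv)
  · exact (congrArg f (DirectSum.decompose_of_mem_ne 𝒱 hv hi)).trans (map_zero f)

theorem IsVertexCoalgebra.counit_eq_zero {𝒱 : ℤ → Submodule F V} {Y : V →ₗ[F] (ℤ → V ⊗[F] V)}
    {c : V →ₗ[F] F} (hY : IsVertexCoalgebra Y c) (h𝒱 : DirectSum.IsInternal 𝒱)
    (hgr : IsGradedMap 𝒱 𝒱 Y) : ∀ r ≠ 0, ∀ v ∈ 𝒱 r, c v = 0 := by
  intro r hr v hv
  obtain ⟨c₀, hc₀, hc₀'⟩ := exists_eqOn_and_eq_zero h𝒱 c 0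
  obtain ⟨cr, hcr, hcr'⟩ := exists_eqOn_and_eq_zero h𝒱 c r
  -- On `(V ⊗ V)₍ᵣ₎` both `c ⊗ cr` and `c₀ ⊗ c` are the restriction of `c ⊗ c` to `V₍₀₎ ⊗ V₍ᵣ₎`.
  have counit_tensor : tensorGrading 𝒱 𝒱 r ≤
      LinearMap.eqLocus (cr ∘ₗ counitLeft V c) (c₀ ∘ₗ counitRight c) := by
    refine tensorGrading_le fun i j hij u hu u' hu' => ?_
    simp only [Int.cast_id] at hij
    simp only [LinearMap.mem_eqLocus, LinearMap.comp_apply, counitLeft, counitRight,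
      LinearMap.rTensor_tmul, LinearMap.lTensor_tmul, LinearEquiv.coe_coe,
      TensorProduct.lid_tmul, TensorProduct.rid_tmul, map_smul, smul_eq_mul]
    rcases eq_or_ne i 0 with rfl | hi
    · rw [hc₀ u hu, hcr u' (by rwa [← hij, zero_add]), mul_comm]
    · rw [hc₀' i hi u hu, hcr' j (by omega) u' hu', mul_zero, mul_zero]
  have hmem : Y v 0 ∈ tensorGrading 𝒱 𝒱 r := by simpa [coeff] using hgr.hasWeight_coeff 0 r v hv
  calc c v = cr (counitLeft V c (Y v 0)) := by rw [hY.leftCounit, if_pos rfl, hcr v hv]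
    _ = c₀ (counitRight c (Y v 0)) := counit_tensor hmem
    _ = 0 := by rw [(hY.cocreation v).2, hc₀' r hr v hv]

end Grading

section CounitSeries

variable {F : Type*} [Field F] {V : Type*} [AddCommGroup V] [Module F V]
  {M : Type*} [AddCommGroup M] [Module F M]
  {YV : V →ₗ[F] (ℤ → V ⊗[F] V)} {YM : M →ₗ[F] (ℤ → V ⊗[F] M)} {c : V →ₗ[F] F}

variable (YV c) in
/-- The coefficient of `x ^ n` in `(Id_V ⊗ c) Y_V(x)`. -/
def counitCoeff (n : ℤ) : V →ₗ[F] V :=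
  counitRight c ∘ₗ coeff YV n

variable (YV c YM) in
/-- `((Id_V ⊗ c) Y_V(z) ⊗ Id_M) Y_M(y) w`; exponents are those of `(y, z)`. -/
def counitTensor (w : M) (e : ℤ × ℤ) : V ⊗[F] M :=
  LinearMap.rTensor M (counitCoeff YV c e.2) (YM w e.1)

theorem counitCoeff_zero (h : Cocreation c YV) : counitCoeff YV c 0 = LinearMap.id :=
  LinearMap.ext fun v => (h v).2

theorem counitCoeff_of_neg (h : Cocreation c YV) {n : ℤ} (hn : n < 0) : counitCoeff YV c n = 0 :=
  LinearMap.ext fun v => (h v).1 n hn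

theorem Truncation.truncatedFst_counitTensor (h : Truncation YM) (w : M) :
    TruncatedFst (counitTensor YV YM c w) := by
  obtain ⟨N, hN⟩ := h w
  exact ⟨N, fun e he => by rw [counitTensor, hN _ he, map_zero]⟩

theorem counitTensor_of_neg (h : Cocreation c YV) (w : M) {e : ℤ × ℤ} (he : e.2 < 0) :
    counitTensor YV YM c w e = 0 := by
  rw [counitTensor, counitCoeff_of_neg h he, LinearMap.rTensor_zero, LinearMap.zero_apply]

theorem lTensor_counitLeft_iterRight (h : LeftCounit c YM) (w : M) (e : ℤ × ℤ) :
    LinearMap.lTensor V (counitLeft M c) (iterRight YM w e) =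
      if e.2 = 0 then YM w e.1 else 0 := by
  have counitLeft_coeff : counitLeft M c ∘ₗ coeff YM e.2 =
      if e.2 = 0 then LinearMap.id else 0 := by
    ext m
    have := h m e.2
    split_ifs with he <;> simpa [coeff, he] using this
  rw [iterRight, ← LinearMap.comp_apply, ← LinearMap.lTensor_comp, counitLeft_coeff]
  split_ifs <;> simp

theorem counitLeft_iterRight (h : LeftCounit c YM) (w : M) (e : ℤ × ℤ) :
    counitLeft (V ⊗[F] M) c (iterRight YM w e) = if e.1 = 0 then YM w e.2 else 0 := by
  have counitLeft_lTensor : counitLeft (V ⊗[F] M) c ∘ₗ LinearMap.lTensor V (coeff YM e.2) =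
      coeff YM e.2 ∘ₗ counitLeft M c := by
    ext v m
    simp [counitLeft]
  refine (LinearMap.congr_fun counitLeft_lTensor (YM w e.1)).trans ?_
  rw [LinearMap.comp_apply, h w e.1]
  split_ifs <;> simp [coeff]

theorem lTensor_counitLeft_leftComm (z : V ⊗[F] (V ⊗[F] M)) :
    LinearMap.lTensor V (counitLeft M c) (TensorProduct.leftComm F V V M z) =
      counitLeft (V ⊗[F] M) c z := by
  suffices h : LinearMap.lTensor V (counitLeft M c) ∘ₗ
      (TensorProduct.leftComm F V V M).toLinearMap = counitLeft (V ⊗[F] M) c from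
    LinearMap.congr_fun h z
  ext u v m
  simp [counitLeft]

theorem lTensor_counitLeft_iterLeft (w : M) (e : ℤ × ℤ) :
    LinearMap.lTensor V (counitLeft M c) (iterLeft YV YM w e) =
      counitTensor YV YM c w e.swap := by
  have lTensor_assoc : LinearMap.lTensor V (counitLeft M c) ∘ₗ
      (TensorProduct.assoc F V V M).toLinearMap = LinearMap.rTensor M (counitRight c) := by
    ext u v m
    simp [counitLeft, counitRight, TensorProduct.smul_tmul]
  rw [counitTensor, counitCoeff, LinearMap.rTensor_comp, ← lTensor_assoc]
  rfl

theorem lTensor_counitRight_iterLeft (v : V) (e : ℤ × ℤ) :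
    LinearMap.lTensor V (counitRight c) (iterLeft YV YV v e) =
      YV (counitCoeff YV c e.2 v) e.1 := by
  have lTensor_assoc : LinearMap.lTensor V (counitRight c) ∘ₗ
      (TensorProduct.assoc F V V V).toLinearMap =
        (TensorProduct.rid F (V ⊗[F] V)).toLinearMap ∘ₗ LinearMap.lTensor (V ⊗[F] V) c := by
    ext u v m
    simp [counitRight]
  have lTensor_assoc_rTensor : LinearMap.lTensor V (counitRight c) ∘ₗ
      (TensorProduct.assoc F V V V).toLinearMap ∘ₗ LinearMap.rTensor V (coeff YV e.1) =
        coeff YV e.1 ∘ₗ counitRight c := by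
    rw [← LinearMap.comp_assoc, lTensor_assoc]
    ext u v
    simp [counitRight]
  exact LinearMap.congr_fun lTensor_assoc_rTensor (YV v e.2)

theorem lTensor_counitRight_leftComm (z : V ⊗[F] (V ⊗[F] V)) :
    LinearMap.lTensor V (counitRight c) (TensorProduct.leftComm F V V V z) =
      TensorProduct.comm F V V (LinearMap.lTensor V (counitRight c) z) := by
  suffices h : LinearMap.lTensor V (counitRight c) ∘ₗ
      (TensorProduct.leftComm F V V V).toLinearMap =
        (TensorProduct.comm F V V).toLinearMap ∘ₗ LinearMap.lTensor V (counitRight c) from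
    LinearMap.congr_fun h z
  ext u v m
  simp [counitRight]

theorem counitRight_rTensor (f : V →ₗ[F] V) (z : V ⊗[F] V) :
    counitRight c (LinearMap.rTensor V f z) = f (counitRight c z) := by
  suffices h : counitRight c ∘ₗ LinearMap.rTensor V f = f ∘ₗ counitRight c from
    LinearMap.congr_fun h z
  ext u v
  simp [counitRight]

theorem map_lTensor_counitLeft_jacobiRight (hc : LeftCounit c YM) (ht : Truncation YM)
    {W : Type*} [AddCommGroup W] [Module F W] (ψ : V ⊗[F] M →ₗ[F] W) (w : M) (a b d : ℤ) :
    ψ (LinearMap.lTensor V (counitLeft M c) (jacobiRight YM w a b d)) =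
      substAdd (F := F) (fun n => ψ (YM w (n + b + 1))) (a, d) := by
  rw [← deltaMul_neg_one_ite_snd fun n => ψ (YM w n)]
  refine (map_deltaMul (ψ ∘ₗ LinearMap.lTensor V (counitLeft M c)) (-1)
    (ht.truncatedFst_iterRight w) a b d).trans (congrArg (deltaMul (-1) · a b d) ?_)
  ext e
  simp only [Function.comp_apply, LinearMap.comp_apply, lTensor_counitLeft_iterRight hc,
    apply_ite ψ, map_zero]

theorem map_lTensor_counitLeft_jacobiLeft (ht : Truncation YM)
    {W : Type*} [AddCommGroup W] [Module F W] (ψ : V ⊗[F] M →ₗ[F] W) (w : M) (a b d : ℤ) :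
    ψ (LinearMap.lTensor V (counitLeft M c) (jacobiLeft YV YM w a b d)) =
      deltaMul (1 : F) (ψ ∘ counitTensor YV YM c w) b d a := by
  refine (map_deltaMul (ψ ∘ₗ LinearMap.lTensor V (counitLeft M c)) 1
    (ht.truncatedFst_iterLeft_swap w) b d a).trans (congrArg (deltaMul 1 · b d a) ?_)
  ext e
  simp only [Function.comp_apply, LinearMap.comp_apply, lTensor_counitLeft_iterLeft,
    Prod.swap_swap]

namespace IsVertexCoalgebra

theorem counitCoeff_counitCoeff (h : IsVertexCoalgebra YV c) (a d : ℤ) (v : V) :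
    counitCoeff YV c a (counitCoeff YV c d v) =
      substAdd (F := F) (fun n => counitCoeff YV c n v) (a, d) := by
  have jacobi := congrFun₃ ((jacobiIdentity_iff h.truncation).1 h.jacobi v) a (-1) d
  have second_term : counitRight c (LinearMap.lTensor V (counitLeft V c)
      (TensorProduct.leftComm F V V V (jacobiRight YV v a d (-1)))) = 0 := by
    rw [lTensor_counitLeft_leftComm]
    refine (map_deltaMul (counitRight c ∘ₗ counitLeft (V ⊗[F] V) c) (-1)
      (h.truncation.truncatedFst_iterRight v) a d (-1)).trans
        (deltaMul_eq_zero_of_le (K := -1) _ (fun e he => ?_) _ _ le_rfl)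
    simp only [Function.comp_apply, LinearMap.comp_apply, counitLeft_iterRight h.leftCounit,
      apply_ite (counitRight c), map_zero, (h.cocreation v).1 e.2 (by omega), ite_self]
  apply_fun fun z => counitRight c (LinearMap.lTensor V (counitLeft V c) z) at jacobi
  rw [Pi.add_apply, Pi.add_apply, Pi.add_apply, skewFlip_apply, map_add, map_add, map_smul,
    map_smul, second_term, smul_zero, add_zero, jacobiLeft_neg_one, lTensor_counitLeft_iterLeft,
    map_lTensor_counitLeft_jacobiRight h.leftCounit h.truncation] at jacobi
  simp only [neg_add_cancel_right] at jacobi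
  exact (jacobi.trans (counitRight_rTensor _ _)).symm

theorem counitCoeff_natCast [CharZero F] (h : IsVertexCoalgebra YV c) (n : ℕ) :
    counitCoeff YV c n = ((n.factorial : F)⁻¹) • Dstar YV c ^ n := by
  induction n with
  | zero => simp [counitCoeff_zero h.cocreation, Module.End.one_eq_id]
  | succ n ih =>
    have smul_succ : ((n + 1 : ℕ) : F) • counitCoeff YV c (n + 1 : ℕ) =
        Dstar YV c ∘ₗ counitCoeff YV c n := by
      ext v
      have := h.counitCoeff_counitCoeff 1 n v
      rw [substAdd_apply, if_pos (by omega), show (1 : ℤ) + n = (n + 1 : ℕ) by push_cast; ring,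
        Int.toNat_natCast, Ring.choose_natCast, Nat.choose_succ_self_right, Int.cast_natCast]
        at this
      exact this.symm
    rw [(eq_inv_smul_iff₀ (Nat.cast_ne_zero.2 n.succ_ne_zero)).2 smul_succ, ih,
      LinearMap.comp_smul, smul_smul, Nat.factorial_succ, Nat.cast_mul, mul_inv, pow_succ']
    rfl

theorem skewFlip_jacobiLeft (h : IsVertexCoalgebra YV c) (v : V) :
    skewFlip F (jacobiLeft YV YV v) = jacobiLeft YV YV v := by
  rw [← (jacobiIdentity_iff h.truncation).1 h.jacobi v, map_add, skewFlip_skewFlip, add_comm]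

theorem skew_symmetry (h : IsVertexCoalgebra YV c) (v : V) (a : ℤ) :
    ∀ᶠ n : ℕ in atTop, YV v a = (-1 : F) ^ a • ∑ i ∈ Finset.range n,
      (-1 : F) ^ i • TensorProduct.comm F V V (YV (counitCoeff YV c i v) (a - i)) := by
  have flip := congrFun₃ (h.skewFlip_jacobiLeft v) a (-1) 0
  apply_fun LinearMap.lTensor V (counitRight c) at flip
  rw [jacobiLeft_neg_one, lTensor_counitRight_iterLeft, counitCoeff_zero h.cocreation,
    LinearMap.id_apply, skewFlip_apply, map_smul, lTensor_counitRight_leftComm, jacobiLeft,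
    deltaMul] at flip
  filter_upwards [((h.truncation.truncatedFst_iterLeft_swap (YV := YV) v).binomSummable
    (F := F) _).eventually_eq_sum 1 (-1) a] with n hn
  rw [← flip, hn, map_sum, map_sum]
  congr 1
  refine Finset.sum_congr rfl fun i _ => ?_
  rw [choose_neg_sub_one]
  simp [lTensor_counitRight_iterLeft, Ring.choose_natCast]

theorem skew_symmetry_rTensor (h : IsVertexCoalgebra YV c) (z : V ⊗[F] M) (a : ℤ) :
    ∀ᶠ n : ℕ in atTop, TensorProduct.assoc F V V M (LinearMap.rTensor M (coeff YV a) z) =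
      (-1 : F) ^ a • ∑ i ∈ Finset.range n, (-1 : F) ^ i • TensorProduct.leftComm F V V M
        (TensorProduct.assoc F V V M (LinearMap.rTensor M (coeff YV (a - i))
          (LinearMap.rTensor M (counitCoeff YV c i) z))) := by
  induction z with
  | zero => simp
  | add z z' hz hz' =>
    filter_upwards [hz, hz'] with n hn hn'
    simp only [map_add, smul_add, Finset.sum_add_distrib]
    rw [hn, hn']
  | tmul v m =>
    filter_upwards [h.skew_symmetry v a] with n hn
    have leftComm_assoc (z : V ⊗[F] V) :
        TensorProduct.leftComm F V V M (TensorProduct.assoc F V V M (z ⊗ₜ m)) =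
          TensorProduct.assoc F V V M (TensorProduct.comm F V V z ⊗ₜ m) := by
      induction z with
      | zero => simp
      | add z z' hz hz' => simp only [TensorProduct.add_tmul, map_add, hz, hz']
      | tmul u u' => simp
    simp only [LinearMap.rTensor_tmul, leftComm_assoc]
    rw [show coeff YV a v = YV v a from rfl, hn, ← TensorProduct.smul_tmul', map_smul,
      TensorProduct.sum_tmul, map_sum]
    simp only [← TensorProduct.smul_tmul', map_smul]
    rfl

end IsVertexCoalgebra

end CounitSeries

section WeaklyCoassociative

variable {F : Type*} [Field F] {V : Type*} [AddCommGroup V] [Module F V]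
  {M : Type*} [AddCommGroup M] [Module F M] {ι : Type*} [AddCommGroupWithOne ι]
  {𝒱 : ℤ → Submodule F V} {YV : V →ₗ[F] (ℤ → V ⊗[F] V)} {c : V →ₗ[F] F}
  {ℳ : ι → Submodule F M} {YM : M →ₗ[F] (ℤ → V ⊗[F] M)}

variable (𝒱 YV ℳ YM) in
/-- Weak coassociativity, where the exponent `k` may depend on the vector `w` and the weights of
`M` lie in any `ι`. -/
def PointwiseWeakCoassociativity : Prop :=
  ∀ φ ∈ gradedDual (tensorGrading 𝒱 (tensorGrading 𝒱 ℳ)), ∀ w : M, ∃ k : ℕ,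
    cauchyMul (binomExp F 1 (k : ℤ))
      (fun e : ℤ × ℤ => φ (iterLeft YV YM w e - iterRightShift YM w e)) = 0

theorem counitTensor_eq_substAdd [CharZero ι] [DecidableEq ι] (hV : IsVertexCoalgebra YV c)
    (h𝒱 : DirectSum.IsInternal 𝒱) (hYV : IsGradedMap 𝒱 𝒱 YV) (hℳ : DirectSum.IsInternal ℳ)
    (hc : LeftCounit c YM) (ht : Truncation YM) (hYM : IsGradedMap 𝒱 ℳ YM)
    (hWC : PointwiseWeakCoassociativity 𝒱 YV ℳ YM) (w : M) :
    counitTensor YV YM c w = substAdd (F := F) (YM w) := by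
  suffices dual_eq : ∀ ψ ∈ gradedDual (tensorGrading 𝒱 ℳ),
      ψ ∘ counitTensor YV YM c w = substAdd (F := F) (ψ ∘ YM w) by
    ext e
    rw [← sub_eq_zero, ← Submodule.mem_bot F,
      ← dualCoannihilator_gradedDual_tensorGrading h𝒱 (dualCoannihilator_gradedDual hℳ),
      Submodule.mem_dualCoannihilator]
    intro ψ hψ
    rw [map_sub, map_substAdd, ← dual_eq ψ hψ, Function.comp_apply, sub_self]
  intro ψ hψ
  have counit_weight : HasWeight (tensorGrading 𝒱 (tensorGrading 𝒱 ℳ)) (tensorGrading 𝒱 ℳ)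
      (-((0 : ℤ) : ι)) (LinearMap.lTensor V (counitLeft M c)) := by
    simpa using (hasWeight_counitLeft (hV.counit_eq_zero h𝒱 hYV)).lTensor
  obtain ⟨k, hk⟩ := hWC _ (counit_weight.comp_mem_gradedDual hψ) w
  obtain ⟨N, hN⟩ := ht w
  obtain ⟨K, hK⟩ := exists_forall_le_apply_eq_zero (deg := id) hℳ.submodule_iSup_eq_top
    hYM.hasWeight_coeff hψ w
  refine eq_substAdd_of_deltaMul_eq (K := min K (-1 - k)) (N := N)
    (fun n hn => by simp [hN n hn]) (fun n hn => hK n (hn.trans (min_le_left _ _)))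
    ((ht.truncatedFst_counitTensor w).map ψ)
    (fun e he => by simp [counitTensor_of_neg hV.cocreation w he]) fun a b d hb => ?_
  have := map_jacobiRight_eq_map_jacobiLeft ht _ hk a (hb.trans (min_le_right _ _)) d
  rw [LinearMap.comp_apply, LinearMap.comp_apply, map_lTensor_counitLeft_jacobiRight hc ht,
    map_lTensor_counitLeft_jacobiLeft ht] at this
  exact this

theorem iterLeft_eq_skewFlip_jacobiLeft (hV : IsVertexCoalgebra YV c) (ht : Truncation YM)
    (hE : ∀ w, counitTensor YV YM c w = substAdd (F := F) (YM w)) (w : M) (a d : ℤ) :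
    iterLeft YV YM w (a, d) = skewFlip F (jacobiLeft YV YM w) a (-1) d := by
  obtain ⟨n, skew, expand⟩ := ((hV.skew_symmetry_rTensor (YM w d) a).and
    (((ht.truncatedFst_iterLeft_swap (YV := YV) w).binomSummable (F := F)
      (-d - 1)).eventually_eq_sum 1 (-1) a)).exists
  rw [skewFlip_apply, jacobiLeft, deltaMul, expand, map_sum]
  refine skew.trans (congrArg _ (Finset.sum_congr rfl fun i _ => ?_))
  have rTensor_counitCoeff : LinearMap.rTensor M (counitCoeff YV c i) (YM w d) =
      ((Ring.choose (d + i) i : ℤ) : F) • YM w (d + i) := by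
    simpa [substAdd_apply, counitTensor] using congrFun (hE w) (d, i)
  rw [rTensor_counitCoeff, choose_neg_sub_one]
  simp only [map_smul, smul_smul, one_pow, mul_one, Function.comp_apply, Prod.swap_prod_mk,
    iterLeft]
  rw [mul_comm, show -1 - (-d - 1) + (i : ℤ) = d + i by ring]

theorem skewFlip_jacobiLeft (hV : IsVertexCoalgebra YV c) (ht : Truncation YM)
    (hE : ∀ w, counitTensor YV YM c w = substAdd (F := F) (YM w)) (w : M) :
    skewFlip F (jacobiLeft YV YM w) = jacobiLeft YV YM w := by
  have hL := ht.isDeltaSeries_jacobiLeft (YV := YV) w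
  have hX := hL.sub hL.skewFlip
  have anti : skewFlip F (jacobiLeft YV YM w - skewFlip F (jacobiLeft YV YM w)) =
      -(jacobiLeft YV YM w - skewFlip F (jacobiLeft YV YM w)) := by
    rw [map_sub, skewFlip_skewFlip, neg_sub]
  have vanish (a b d : ℤ) (hb : b ≤ -1) :
      (jacobiLeft YV YM w - skewFlip F (jacobiLeft YV YM w)) a b d = 0 := by
    refine hX.eq_zero_of_le (fun a d => ?_) a hb d
    simp only [Pi.sub_apply]
    rw [jacobiLeft_neg_one, iterLeft_eq_skewFlip_jacobiLeft hV ht hE, sub_self]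
  refine (sub_eq_zero.1 (hX.eq_zero vanish fun a b d hd => ?_)).symm
  rw [← neg_eq_zero]
  refine (congrFun₃ anti a b d).symm.trans ?_
  rw [skewFlip_apply, vanish a d b hd, map_zero, smul_zero]

theorem exists_forall_le_apply_iterRight_eq_zero [CharZero ι] (hℳ : ⨆ j, ℳ j = ⊤)
    (ht : Truncation YM) (hYM : IsGradedMap 𝒱 ℳ YM) {φ : Module.Dual F (V ⊗[F] (V ⊗[F] M))}
    (hφ : φ ∈ gradedDual (tensorGrading 𝒱 (tensorGrading 𝒱 ℳ))) (w : M) :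
    ∃ K, ∀ e : ℤ × ℤ, e.2 ≤ K → φ (iterRight YM w e) = 0 := by
  have weight (e : ℤ × ℤ) : HasWeight ℳ (tensorGrading 𝒱 (tensorGrading 𝒱 ℳ))
      (-((e.1 + e.2 : ℤ) : ι)) (LinearMap.lTensor V (coeff YM e.2) ∘ₗ coeff YM e.1) := by
    rw [Int.cast_add, neg_add]
    exact (hYM.hasWeight_coeff e.2).lTensor.comp (hYM.hasWeight_coeff e.1)
  obtain ⟨K, hK⟩ := exists_forall_le_apply_eq_zero hℳ weight hφ w
  obtain ⟨N, hN⟩ := ht.truncatedFst_iterRight w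
  refine ⟨K - N, fun e he => ?_⟩
  rcases le_or_gt e.1 N with h | h
  · exact hK e (by omega)
  · rw [hN e h, map_zero]

variable (YV YM) in
/-- The left-hand side minus the right-hand side of the Jacobi identity. -/
noncomputable def jacobiDefect (w : M) : ℤ → ℤ → ℤ → V ⊗[F] (V ⊗[F] M) :=
  jacobiRight YM w + skewFlip F (jacobiRight YM w) - jacobiLeft YV YM w

theorem Truncation.isDeltaSeries_jacobiDefect (ht : Truncation YM) (w : M) :
    IsDeltaSeries (jacobiDefect YV YM w) :=
  have hR := ht.isDeltaSeries_jacobiRight w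
  (hR.add hR.skewFlip).sub (ht.isDeltaSeries_jacobiLeft w)

theorem skewFlip_jacobiDefect {w : M}
    (hL : skewFlip F (jacobiLeft YV YM w) = jacobiLeft YV YM w) :
    skewFlip F (jacobiDefect YV YM w) = jacobiDefect YV YM w := by
  rw [jacobiDefect, map_sub, map_add, skewFlip_skewFlip, hL, add_comm]

theorem exists_forall_le_apply_jacobiDefect_eq_zero [CharZero ι] (hℳ : ⨆ j, ℳ j = ⊤)
    (ht : Truncation YM) (hYM : IsGradedMap 𝒱 ℳ YM)
    (hWC : PointwiseWeakCoassociativity 𝒱 YV ℳ YM) {φ : Module.Dual F (V ⊗[F] (V ⊗[F] M))}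
    (hφ : φ ∈ gradedDual (tensorGrading 𝒱 (tensorGrading 𝒱 ℳ))) (w : M) :
    ∃ K : ℤ, ∀ a b d : ℤ, b ≤ K → φ (jacobiDefect YV YM w a b d) = 0 := by
  obtain ⟨k, hk⟩ := hWC φ hφ w
  obtain ⟨K, hK⟩ := exists_forall_le_apply_iterRight_eq_zero hℳ ht hYM
    (hasWeight_leftComm.comp_mem_gradedDual hφ) w
  refine ⟨min K (-1 - k), fun a b d hb => ?_⟩
  have second_term : φ (TensorProduct.leftComm F V V M (jacobiRight YM w a d b)) = 0 :=
    (map_deltaMul (φ ∘ₗ (TensorProduct.leftComm F V V M).toLinearMap) (-1)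
      (ht.truncatedFst_iterRight w) a d b).trans
        (deltaMul_eq_zero_of_le _ hK a d (hb.trans (min_le_left _ _)))
  simp only [jacobiDefect, Pi.sub_apply, Pi.add_apply, skewFlip_apply]
  rw [map_sub, map_add, map_smul, second_term, smul_zero, add_zero,
    map_jacobiRight_eq_map_jacobiLeft ht φ hk a (hb.trans (min_le_right _ _)) d, sub_self]

theorem jacobiIdentity_of_skewFlip_jacobiLeft [CharZero ι] [DecidableEq ι]
    (h𝒱 : DirectSum.IsInternal 𝒱) (hℳ : DirectSum.IsInternal ℳ) (ht : Truncation YM)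
    (hYM : IsGradedMap 𝒱 ℳ YM) (hWC : PointwiseWeakCoassociativity 𝒱 YV ℳ YM)
    (hL : ∀ w, skewFlip F (jacobiLeft YV YM w) = jacobiLeft YV YM w) :
    JacobiIdentity YV YM := by
  refine (jacobiIdentity_iff ht).2 fun w => sub_eq_zero.1 (?_ : jacobiDefect YV YM w = 0)
  have low_degree {φ} (hφ : φ ∈ gradedDual (tensorGrading 𝒱 (tensorGrading 𝒱 ℳ))) :=
    exists_forall_le_apply_jacobiDefect_eq_zero hℳ.submodule_iSup_eq_top ht hYM hWC hφ w
  suffices dual_eq_zero : ∀ φ ∈ gradedDual (tensorGrading 𝒱 (tensorGrading 𝒱 ℳ)),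
      (fun a b d => φ (jacobiDefect YV YM w a b d)) = 0 by
    ext a b d
    rw [Pi.zero_apply, Pi.zero_apply, Pi.zero_apply, ← Submodule.mem_bot F,
      ← dualCoannihilator_gradedDual_tensorGrading h𝒱
        (dualCoannihilator_gradedDual_tensorGrading h𝒱 (dualCoannihilator_gradedDual hℳ)),
      Submodule.mem_dualCoannihilator]
    exact fun φ hφ => congrFun₃ (dual_eq_zero φ hφ) a b d
  intro φ hφ
  obtain ⟨K, hK⟩ := low_degree hφ
  obtain ⟨K', hK'⟩ := low_degree (hasWeight_leftComm.comp_mem_gradedDual hφ)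
  refine ((ht.isDeltaSeries_jacobiDefect w).map φ).eq_zero (K := min K K')
    (fun a b d hb => hK a b d (by omega)) fun a b d hd => ?_
  rw [← skewFlip_jacobiDefect (hL w), skewFlip_apply, map_smul]
  exact (congrArg _ (hK' a d b (by omega))).trans (smul_zero _)

theorem expTensor_Dstar_eq_counitTensor [CharZero F] (hV : IsVertexCoalgebra YV c) (w : M) :
    expTensor (Dstar YV c) YM w = counitTensor YV YM c w := by
  ext e
  rw [expTensor]
  split_ifs with h
  · obtain ⟨n, hn⟩ := Int.eq_ofNat_of_zero_le h
    rw [counitTensor, hn, Int.toNat_natCast, hV.counitCoeff_natCast, LinearMap.rTensor_smul,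
      LinearMap.smul_apply]
  · rw [counitTensor_of_neg hV.cocreation w (not_le.1 h)]

end WeaklyCoassociative

end VertexCoalgebra

open VertexCoalgebra in
theorem propositionP_general {F : Type*} [Field F] {V : Type*} [AddCommGroup V] [Module F V]
    {M : Type*} [AddCommGroup M] [Module F M] {ι : Type*} [AddCommGroupWithOne ι] [CharZero ι]
    [DecidableEq ι] {𝒱 : ℤ → Submodule F V} {YV : V →ₗ[F] (ℤ → V ⊗[F] V)} {c : V →ₗ[F] F}
    {ℳ : ι → Submodule F M} {YM : M →ₗ[F] (ℤ → V ⊗[F] M)} (hV : IsVertexCoalgebra YV c)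
    (h𝒱 : DirectSum.IsInternal 𝒱) (hYV : IsGradedMap 𝒱 𝒱 YV) (hℳ : DirectSum.IsInternal ℳ)
    (hc : LeftCounit c YM) (ht : Truncation YM) (hYM : IsGradedMap 𝒱 ℳ YM)
    (hWC : PointwiseWeakCoassociativity 𝒱 YV ℳ YM) :
    JacobiIdentity YV YM ∧ ∀ w : M, counitTensor YV YM c w = substAdd (F := F) (YM w) := by
  have hE := counitTensor_eq_substAdd hV h𝒱 hYV hℳ hc ht hYM hWC
  exact ⟨jacobiIdentity_of_skewFlip_jacobiLeft h𝒱 hℳ ht hYM hWC (skewFlip_jacobiLeft hV ht hE),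
    hE⟩

theorem propositionP {F : Type*} [Field F] [CharZero F]
    {V : Type*} [AddCommGroup V] [Module F V] {M : Type*} [AddCommGroup M] [Module F M]
    (𝒱 : ℤ → Submodule F V) (YV : V →ₗ[F] (ℤ → V ⊗[F] V)) (c : V →ₗ[F] F)
    (hV : VertexCoalgebra.IsGradedVertexCoalgebra 𝒱 YV c)
    (ℳ : ℚ → Submodule F M) (YM : M →ₗ[F] (ℤ → V ⊗[F] M))
    (hM : VertexCoalgebra.IsGradedPrecomodule 𝒱 c ℳ YM)
    (hWC : VertexCoalgebra.WeakCoassociativity 𝒱 YV ℳ YM) :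
    VertexCoalgebra.JacobiIdentity YV YM ∧
      ∀ w : M, VertexCoalgebra.expTensor (VertexCoalgebra.Dstar YV c) YM w =
        VertexCoalgebra.substAdd (F := F) (YM w) := by
  obtain ⟨hJ, hE⟩ := propositionP_general hV.toIsVertexCoalgebra hV.grading.isInternal hV.graded
    hM.grading.isInternal hM.leftCounit hM.truncation hM.graded fun φ hφ w =>
      (hWC φ hφ).imp fun _ hk => hk w
  refine ⟨hJ, fun w => ?_⟩
  rw [← hE w, VertexCoalgebra.expTensor_Dstar_eq_counitTensor hV.toIsVertexCoalgebra]
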